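/- For a set $\mathcal A$ of positive integers let $\mathfrak C_{\mathcal A}\subset\mathbb R$ be the set of values of the infinite continued fractions $[a_1,a_2,\dots]=\cfrac{1}{a_1+\cfrac{1}{a_2+\cdots}}$ with all $a_j\in\mathcal A$, let $\delta_{\mathcal A}$ be its Hausdorff dimension, let $\mathfrak R_{\mathcal A}\subset\mathbb Q$ be the set of partial convergents $[a_1,\dots,a_k]$, $k\ge1$, of these continued fractions, and let $\mathfrak D_{\mathcal A}$ be the set of denominators, in lowest terms, of the elements of $\mathfrak R_{\mathcal A}$. Hensley's conjecture asserts that for every finite alphabet $\mathcal A$ of positive integers, $\mathfrak D_{\mathcal A}$ contains every sufficiently large integer if and only if $\delta_{\mathcal A}>1/2$. **Lemma.** Let $\mathcal A=\{2,4,6,8,10\}$. Then: 1. $\delta_{\mathcal A}=0.517\dots$, that is, $0.517\le\delta_{\mathcal A}<0.518$; in particular $\delta_{\mathcal A}>1/2$. 2. Every fraction in $\mathfrak R_{\mathcal A}$, written in lowest terms, is of the form $\dfrac{2m}{4n+1}$ or $\dfrac{4n+1}{2m}$ with integers $m\ge1$, $n\ge0$. 3. The residues modulo $4$ of the elements of $\mathfrak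 D_{\mathcal A}$ are exactly $0,1,2$; in particular no denominator is congruent to $3$ modulo $4$. 4. Infinitely many positive integers are missing from $\mathfrak D_{\mathcal A}$; equivalently, $\mathfrak D_{\mathcal A}$ does not contain every sufficiently large integer. Consequently Hensley's conjecture, as stated above, is false. -/

import Mathlib

open Filter Topology

namespace Zaremba

/-- The infinite continued fraction `[a 0, a 1, a 2, …] = 1 / (a 0 + 1 / (a 1 + 1 / (a 2 + ⋯)))`
with integer part `0`, partial numerators `1` and partial quotients `a 0, a 1, …`. -/
def contFrac (K : Type*) [DivisionRing K] (a : ℕ → ℕ) : GenContFract K where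
  h := 0
  s := Stream'.Seq.ofStream (fun j => ⟨1, (a j : K)⟩)

/-- The set of values `[a₁, a₂, …]` of the infinite continued fractions
all of whose partial quotients lie in the alphabet `A`. -/
def cantorSet (A : Set ℕ) : Set ℝ :=
  {x | ∃ a : ℕ → ℕ, (∀ j, a j ∈ A) ∧ Tendsto (fun k => (contFrac ℝ a).convs k) atTop (𝓝 x)}

/-- The partial convergents `[a₁, …, a_k]`, `k ≥ 1`, of the infinite continued fractions
all of whose partial quotients lie in the alphabet `A`. -/
def rationals (A : Set ℕ) : Set ℚ :=
  {q | ∃ a : ℕ → ℕ, (∀ j, a j ∈ A) ∧ ∃ k : ℕ, 1 ≤ k ∧ q = (contFrac ℚ a).convs k}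

/-- The denominators, in lowest terms, of the fractions in `rationals A`. -/
def denominators (A : Set ℕ) : Set ℕ :=
  {d | ∃ q ∈ rationals A, q.den = d}

/-- Hensley's conjecture: for every finite alphabet `A` of positive integers, the denominators
contain every sufficiently large integer if and only if the Cantor set has Hausdorff dimension
greater than `1 / 2`. -/
def HensleyConjecture : Prop :=
  ∀ A : Finset ℕ, (∀ a ∈ A, 1 ≤ a) →
    ((∀ᶠ d : ℕ in atTop, d ∈ denominators (A : Set ℕ)) ↔
      ENNReal.ofReal (1 / 2) < dimH (cantorSet (A : Set ℕ)))

/-- The alphabet `{2, 4, 6, 8, 10}`. -/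
def evenAlphabet : Set ℕ := {2, 4, 6, 8, 10}

end Zaremba

namespace Zaremba

/-! The arithmetic obstruction is a parity invariant. Prepending a partial quotient `a` turns `u/v`
into `v/(a*v+u)`. For even `a` this exchanges the shapes `2m/(4n+1)` and `(4n+1)/(2m)`, and the
process starts at `1/a`, of the second shape. So no denominator is 3 mod 4
(`finiteContFrac_eq_div`), and this refutes the conjecture once the dimension is known to exceed
1/2.

The dimension is bracketed with the transfer operator `L f x = ∑ (a+x)^(-2s) * f (1/(a+x))` on `[0,
1/2]`. A test function bounded below by a positive constant with `L f ≤ f` makes the sums of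
`diam^s` over the level-`n` pieces bounded, so the dimension is at most `s` (`dimH_le_of_transfer`).
If `L f ≥ c*f` with `c > 1`, a high iterate beats the distortion of the branches, and a covering
argument gives dimension at least `s` (`le_dimH_of_transfer`). Explicit quadratics, close to
eigenfunctions, work for `2s = 1 + 3/88` (`s = 0.51704…`) and `2s = 1 + 1/28` (`s = 0.51785…`). -/

/-! ### Numerical inequalities for the transfer operator. -/

theorem one_div_rpow_one_add_ge {t t₀ p c : ℝ} (ht : 0 < t) (ht₀ : 0 < t₀) (hp₀ : 0 ≤ p)
    (hp₁ : p ≤ 1) (hc : c ≤ t₀ ^ (-p)) (hc₀ : 0 ≤ c) :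
    (1 / t) * (c * (1 - p * (t / t₀ - 1))) ≤ (1 / t) ^ (1 + p) := by
  have h1 : (t / t₀) ^ p ≤ 1 + p * (t / t₀ - 1) := by
    have := rpow_one_add_le_one_add_mul_self (s := t / t₀ - 1) (p := p)
      (by have := div_pos ht ht₀; linarith) hp₀ hp₁
    simpa using this
  have hpos : 0 < (t / t₀) ^ p := Real.rpow_pos_of_pos (div_pos ht ht₀) _
  -- With `u = p * (t / t₀ - 1)`: Bernoulli bounds the power by `1 + u`, and `(1 - u) * (1 + u) ≤
  -- 1`.
  have h2 : 1 - p * (t / t₀ - 1) ≤ (t / t₀) ^ (-p) := by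
    rw [Real.rpow_neg (div_pos ht ht₀).le, ← one_div, le_div_iff₀ hpos]
    rcases le_or_gt (1 - p * (t / t₀ - 1)) 0 with h | h
    · nlinarith
    · nlinarith [sq_nonneg (p * (t / t₀ - 1))]
  have h3 : (1 / t) ^ (1 + p) = (1 / t) * (t₀ ^ (-p) * (t / t₀) ^ (-p)) := by
    rw [← Real.mul_rpow ht₀.le (div_pos ht ht₀).le, mul_div_cancel₀ _ ht₀.ne',
      Real.rpow_add (by positivity), Real.rpow_one, one_div, Real.inv_rpow ht.le, Real.rpow_neg ht.le]
  rw [h3]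
  have h4 : 0 ≤ (t / t₀) ^ (-p) := Real.rpow_nonneg (div_pos ht ht₀).le _
  refine mul_le_mul_of_nonneg_left ?_ (by positivity)
  exact (mul_le_mul_of_nonneg_left h2 hc₀).trans (mul_le_mul_of_nonneg_right hc h4)

theorem one_div_rpow_one_add_le {t t₀ p c : ℝ} (ht : 0 < t) (ht₀ : 0 < t₀) (hp₀ : 0 ≤ p)
    (hp₁ : p ≤ 1) (hc : t₀ ^ (-p) ≤ c) :
    (1 / t) ^ (1 + p) ≤ (1 / t) * (c * (1 + p * (t₀ / t - 1))) := by
  have h1 : (t₀ / t) ^ p ≤ 1 + p * (t₀ / t - 1) := by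
    have := rpow_one_add_le_one_add_mul_self (s := t₀ / t - 1) (p := p)
      (by have := div_pos ht₀ ht; linarith) hp₀ hp₁
    simpa using this
  have hpos : 0 < (t₀ / t) ^ p := Real.rpow_pos_of_pos (div_pos ht₀ ht) _
  have h3 : (1 / t) ^ (1 + p) = (1 / t) * (t₀ ^ (-p) * (t₀ / t) ^ p) := by
    rw [Real.rpow_neg ht₀.le, Real.div_rpow ht₀.le ht.le, ← mul_div_assoc, inv_mul_cancel₀ (by positivity),
      Real.rpow_add (by positivity), Real.rpow_one, one_div, Real.inv_rpow ht.le, one_div]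
  have h4 : 0 ≤ t₀ ^ (-p) := Real.rpow_nonneg ht₀.le _
  rw [h3]
  gcongr
  exact h4.trans hc

/-- Clearing the rational exponent turns a numerical bound on a real power into an inequality
between integer powers, which `norm_num` can decide. -/
theorem le_rpow_neg_div {t c : ℝ} (ht : 0 < t) (hc : 0 ≤ c) {m n : ℕ} (hn : n ≠ 0)
    (h : c ^ n * t ^ m ≤ 1) : c ≤ t ^ (-(m / n : ℝ)) := by
  rw [← pow_le_pow_iff_left₀ hc (Real.rpow_nonneg ht.le _) hn, ← Real.rpow_natCast (t ^ _),
    ← Real.rpow_mul ht.le, neg_mul, div_mul_cancel₀ _ (Nat.cast_ne_zero.2 hn), Real.rpow_neg ht.le,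
    Real.rpow_natCast, ← one_div, le_div_iff₀ (by positivity)]
  exact h

theorem rpow_neg_div_le {t c : ℝ} (ht : 0 < t) (hc : 0 ≤ c) {m n : ℕ} (hn : n ≠ 0)
    (h : 1 ≤ c ^ n * t ^ m) : t ^ (-(m / n : ℝ)) ≤ c := by
  rw [← pow_le_pow_iff_left₀ (Real.rpow_nonneg ht.le _) hc hn, ← Real.rpow_natCast (t ^ _),
    ← Real.rpow_mul ht.le, neg_mul, div_mul_cancel₀ _ (Nat.cast_ne_zero.2 hn), Real.rpow_neg ht.le,
    Real.rpow_natCast, ← one_div, div_le_iff₀ (by positivity)]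
  exact h

/-- Replacing the real power by its Bernoulli minorant around `t₀` leaves a rational function of
`x`; after clearing denominators, `h` is a polynomial inequality of degree 5. -/
theorem lowerTerm_ge {a t₀ c b₀ b₁ b₂ x : ℝ} (hx : 0 ≤ x) (ha : 0 < a) (ht₀ : 0 < t₀)
    (hc₀ : 0 ≤ c) (hc : c ^ 88 * t₀ ^ 3 ≤ 1) (hf : 0 < 1 - 0.288 * (1 / (a + x)) + 0.075 * (1 / (a + x)) ^ 2)
    (h : (b₀ + b₁ * x + b₂ * x ^ 2) * ((a + x) ^ 3 * t₀) ≤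
      c * (t₀ - 3 / 88 * (a + x - t₀)) * ((a + x) ^ 2 - 0.288 * (a + x) + 0.075)) :
    b₀ + b₁ * x + b₂ * x ^ 2 ≤ (1 / (a + x)) ^ (1 + 3 / 88 : ℝ) *
      (1 - 0.288 * (1 / (a + x)) + 0.075 * (1 / (a + x)) ^ 2) := by
  have ht : 0 < a + x := by linarith
  have hc' : c ≤ t₀ ^ (-(3 / 88) : ℝ) := by
    have := le_rpow_neg_div (m := 3) (n := 88) ht₀ hc₀ (by norm_num) hc
    simpa using this
  have key := one_div_rpow_one_add_ge ht ht₀ (p := 3 / 88) (by norm_num) (by norm_num) hc' hc₀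
  refine le_trans ?_ (mul_le_mul_of_nonneg_right key hf.le)
  generalize a + x = t at *
  rw [← le_div_iff₀ (by positivity)] at h
  refine h.trans (le_of_eq ?_)
  field_simp

theorem upperTerm_le {a t₀ c b₀ b₁ b₂ x : ℝ} (hx : 0 ≤ x) (ha : 0 < a) (ht₀ : 0 < t₀)
    (hc₀ : 0 ≤ c) (hc : 1 ≤ c ^ 28 * t₀ ^ 1) (hf : 0 < 1 - 0.294 * (1 / (a + x)) + 0.085 * (1 / (a + x)) ^ 2)
    (h : c * (a + x + 1 / 28 * (t₀ - (a + x))) * ((a + x) ^ 2 - 0.294 * (a + x) + 0.085) ≤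
      (b₀ + b₁ * x + b₂ * x ^ 2) * (a + x) ^ 4) :
    (1 / (a + x)) ^ (1 + 1 / 28 : ℝ) *
      (1 - 0.294 * (1 / (a + x)) + 0.085 * (1 / (a + x)) ^ 2) ≤ b₀ + b₁ * x + b₂ * x ^ 2 := by
  have ht : 0 < a + x := by linarith
  have hc' : t₀ ^ (-(1 / 28) : ℝ) ≤ c := by
    have := rpow_neg_div_le (m := 1) (n := 28) ht₀ hc₀ (by norm_num) hc
    simpa using this
  have key := one_div_rpow_one_add_le ht ht₀ (p := 1 / 28) (by norm_num) (by norm_num) hc'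
  refine le_trans (mul_le_mul_of_nonneg_right key hf.le) ?_
  generalize a + x = t at *
  rw [← div_le_iff₀ (by positivity)] at h
  refine (le_of_eq ?_).trans h
  field_simp

theorem lowerWeight_bounds {x : ℝ} (h₀ : 0 ≤ x) (h₁ : x ≤ 1 / 2) :
    1 / 2 ≤ 1 - 0.288 * x + 0.075 * x ^ 2 ∧ 1 - 0.288 * x + 0.075 * x ^ 2 ≤ 1 := by
  constructor <;> nlinarith

theorem upperWeight_bounds {x : ℝ} (h₀ : 0 ≤ x) (h₁ : x ≤ 1 / 2) :
    1 / 2 ≤ 1 - 0.294 * x + 0.085 * x ^ 2 ∧ 1 - 0.294 * x + 0.085 * x ^ 2 ≤ 1 := by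
  constructor <;> nlinarith

theorem one_div_add_mem {a x : ℝ} (ha : 2 ≤ a) (h₀ : 0 ≤ x) :
    0 ≤ 1 / (a + x) ∧ 1 / (a + x) ≤ 1 / 2 :=
  ⟨by positivity, one_div_le_one_div_of_le (by norm_num) (by linarith)⟩

theorem lower_transfer {x : ℝ} (h₀ : 0 ≤ x) (h₁ : x ≤ 1 / 2) :
    1.0003 * (1 - 0.288 * x + 0.075 * x ^ 2) ≤
      ∑ a ∈ ({2, 4, 6, 8, 10} : Finset ℕ), (1 / ((a : ℝ) + x)) ^ (1 + 3 / 88 : ℝ) *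
        (1 - 0.288 * (1 / ((a : ℝ) + x)) + 0.075 * (1 / ((a : ℝ) + x)) ^ 2) := by
  have hf : ∀ a : ℝ, 2 ≤ a → 0 < 1 - 0.288 * (1 / (a + x)) + 0.075 * (1 / (a + x)) ^ 2 := by
    intro a ha
    have := one_div_add_mem ha h₀
    linarith [(lowerWeight_bounds this.1 this.2).1]
  have hy : 0 ≤ 1 / 2 - x := by linarith
  -- The Bernstein basis of degree 5 on `[0, 1/2]`: each polynomial inequality below follows as a
  -- linear combination of these.
  have e0 := pow_nonneg hy 5
  have e1 := mul_nonneg h₀ (pow_nonneg hy 4)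
  have e2 := mul_nonneg (pow_nonneg h₀ 2) (pow_nonneg hy 3)
  have e3 := mul_nonneg (pow_nonneg h₀ 3) (pow_nonneg hy 2)
  have e4 := mul_nonneg (pow_nonneg h₀ 4) hy
  have e5 := pow_nonneg h₀ 5
  -- Each summand gets a quadratic minorant. Here `t₀ = a + 0.2` lies inside the range of `a + x`,
  -- and `c` is a lower approximation to `t₀ ^ (-3/88)`.
  have k2 := lowerTerm_ge (a := 2) (t₀ := 2.2) (c := 0.97347) (b₀ := 0.42671) (b₁ := -0.19014)
    (b₂ := 0.06303) h₀ (by norm_num) (by norm_num) (by norm_num) (by norm_num)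
    (hf 2 (by norm_num)) (by linarith)
  have k4 := lowerTerm_ge (a := 4) (t₀ := 4.2) (c := 0.95225) (b₀ := 0.22236) (b₁ := -0.05332)
    (b₂ := 0.01059) h₀ (by norm_num) (by norm_num) (by norm_num) (by norm_num)
    (hf 4 (by norm_num)) (by linarith)
  have k6 := lowerTerm_ge (a := 6) (t₀ := 6.2) (c := 0.93969) (b₀ := 0.14956) (b₁ := -0.02453)
    (b₂ := 0.00348) h₀ (by norm_num) (by norm_num) (by norm_num) (by norm_num)
    (hf 6 (by norm_num)) (by linarith)
  have k8 := lowerTerm_ge (a := 8) (t₀ := 8.2) (c := 0.93078) (b₀ := 0.11237) (b₁ := -0.014)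
    (b₂ := 0.00155) h₀ (by norm_num) (by norm_num) (by norm_num) (by norm_num)
    (hf 8 (by norm_num)) (by linarith)
  have k10 := lowerTerm_ge (a := 10) (t₀ := 10.2) (c := 0.92388) (b₀ := 0.08983) (b₁ := -0.00902)
    (b₂ := 0.00082) h₀ (by norm_num) (by norm_num) (by norm_num) (by norm_num)
    (hf 10 (by norm_num)) (by linarith)
  rw [Finset.sum_insert (by decide), Finset.sum_insert (by decide), Finset.sum_insert (by decide),
    Finset.sum_insert (by decide), Finset.sum_singleton]
  push_cast
  nlinarith

theorem upper_transfer {x : ℝ} (h₀ : 0 ≤ x) (h₁ : x ≤ 1 / 2) :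
    ∑ a ∈ ({2, 4, 6, 8, 10} : Finset ℕ), (1 / ((a : ℝ) + x)) ^ (1 + 1 / 28 : ℝ) *
        (1 - 0.294 * (1 / ((a : ℝ) + x)) + 0.085 * (1 / ((a : ℝ) + x)) ^ 2) ≤
      1 - 0.294 * x + 0.085 * x ^ 2 := by
  have hf : ∀ a : ℝ, 2 ≤ a → 0 < 1 - 0.294 * (1 / (a + x)) + 0.085 * (1 / (a + x)) ^ 2 := by
    intro a ha
    have := one_div_add_mem ha h₀
    linarith [(upperWeight_bounds this.1 this.2).1]
  have hy : 0 ≤ 1 / 2 - x := by linarith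
  -- Degree 6 is needed here, since clearing denominators multiplies the quadratic by `(a + x) ^ 4`.
  have e0 := pow_nonneg hy 6
  have e1 := mul_nonneg h₀ (pow_nonneg hy 5)
  have e2 := mul_nonneg (pow_nonneg h₀ 2) (pow_nonneg hy 4)
  have e3 := mul_nonneg (pow_nonneg h₀ 3) (pow_nonneg hy 3)
  have e4 := mul_nonneg (pow_nonneg h₀ 4) (pow_nonneg hy 2)
  have e5 := mul_nonneg (pow_nonneg h₀ 5) hy
  have e6 := pow_nonneg h₀ 6
  have k2 := upperTerm_le (a := 2) (t₀ := 2.2) (c := 0.97224) (b₀ := 0.42663) (b₁ := -0.19166)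
    (b₂ := 0.066) h₀ (by norm_num) (by norm_num) (by norm_num) (by norm_num)
    (hf 2 (by norm_num)) (by linarith)
  have k4 := upperTerm_le (a := 4) (t₀ := 4.2) (c := 0.95004) (b₀ := 0.22173) (b₁ := -0.05338)
    (b₂ := 0.01097) h₀ (by norm_num) (by norm_num) (by norm_num) (by norm_num)
    (hf 4 (by norm_num)) (by linarith)
  have k6 := upperTerm_le (a := 6) (t₀ := 6.2) (c := 0.93692) (b₀ := 0.14907) (b₁ := -0.02452)
    (b₂ := 0.0036) h₀ (by norm_num) (by norm_num) (by norm_num) (by norm_num)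
    (hf 6 (by norm_num)) (by linarith)
  have k8 := upperTerm_le (a := 8) (t₀ := 8.2) (c := 0.92761) (b₀ := 0.11196) (b₁ := -0.01398)
    (b₂ := 0.0016) h₀ (by norm_num) (by norm_num) (by norm_num) (by norm_num)
    (hf 8 (by norm_num)) (by linarith)
  have k10 := upperTerm_le (a := 10) (t₀ := 10.2) (c := 0.92041) (b₀ := 0.0895) (b₁ := -0.00901)
    (b₂ := 0.00084) h₀ (by norm_num) (by norm_num) (by norm_num) (by norm_num)
    (hf 10 (by norm_num)) (by linarith)
  rw [Finset.sum_insert (by decide), Finset.sum_insert (by decide), Finset.sum_insert (by decide),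
    Finset.sum_insert (by decide), Finset.sum_singleton]
  push_cast
  nlinarith


/-! ### Positive Hausdorff measure from finite covers. -/

/-- Induction on the size of the cover replaces a mass distribution. A set meeting two pieces `φ i
'' K` already has diameter at least `d`. Otherwise the sets meeting different pieces form disjoint
subfamilies; pulling the `i`-th one back by `φ i` gives a smaller cover of `K`, with diameters
enlarged by at most `1 / ρ i`, and the bounds recombine through `∑ ρ i ^ s ≥ 1`. -/
theorem rpow_le_sum_ediam_rpow {X ι κ : Type*} [PseudoEMetricSpace X] [Fintype ι] [Nontrivial ι]
    {K : Set X} (hK : K.Nonempty) {φ : ι → X → X} (hφ : ∀ i, Set.MapsTo (φ i) K K)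
    {ρ : ι → ENNReal} (hρ : ∀ i, ∀ x ∈ K, ∀ y ∈ K, ρ i * edist x y ≤ edist (φ i x) (φ i y))
    (hρ₀ : ∀ i, ρ i ≠ 0) (hρ' : ∀ i, ρ i ≠ ⊤) {d : ENNReal}
    (hd : ∀ i j, i ≠ j → ∀ x ∈ K, ∀ y ∈ K, d ≤ edist (φ i x) (φ j y))
    {s : ℝ} (hs : 0 ≤ s) (hsum : 1 ≤ ∑ i, ρ i ^ s) (T : Finset κ) (U : κ → Set X)
    (hU : K ⊆ ⋃ k ∈ T, U k) : d ^ s ≤ ∑ k ∈ T, Metric.ediam (U k) ^ s := by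
  classical
  induction T using Finset.strongInduction generalizing U with
  | H T ih =>
  by_cases hbig : ∃ k ∈ T, ∃ i j, i ≠ j ∧ (U k ∩ φ i '' K).Nonempty ∧ (U k ∩ φ j '' K).Nonempty
  · obtain ⟨k, hk, i, j, hij, ⟨_, hxU, x, hx, rfl⟩, ⟨_, hyU, y, hy, rfl⟩⟩ := hbig
    calc d ^ s ≤ Metric.ediam (U k) ^ s :=
          ENNReal.rpow_le_rpow
            ((hd i j hij x hx y hy).trans (Metric.edist_le_ediam_of_mem hxU hyU)) hs
      _ ≤ _ := Finset.single_le_sum (f := fun k => Metric.ediam (U k) ^ s) (fun _ _ => zero_le) hk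
  push Not at hbig
  set S : ι → Finset κ := fun i => T.filter fun k => (U k ∩ φ i '' K).Nonempty with hS
  have hcov : ∀ i, ∀ x ∈ K, ∃ k ∈ S i, φ i x ∈ U k := by
    intro i x hx
    obtain ⟨k, hk, hxk⟩ := Set.mem_iUnion₂.1 (hU (hφ i hx))
    exact ⟨k, Finset.mem_filter.2 ⟨hk, φ i x, hxk, x, hx, rfl⟩, hxk⟩
  have hdisj : ∀ i j, i ≠ j → Disjoint (S i) (S j) := by
    intro i j hij
    rw [Finset.disjoint_left]
    intro k hki hkj
    rw [Finset.mem_filter] at hki hkj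
    exact hkj.2.ne_empty (hbig k hki.1 i j hij hki.2)
  -- Some other piece `j` needs a covering set, and by disjointness that set is not in `S i`.
  have hlt : ∀ i, S i ⊂ T := by
    intro i
    obtain ⟨j, hj⟩ := exists_ne i
    obtain ⟨x, hx⟩ := hK
    obtain ⟨k, hk, -⟩ := hcov j x hx
    refine Finset.ssubset_iff_of_subset (Finset.filter_subset _ _) |>.2
      ⟨k, (Finset.mem_filter.1 hk).1, Finset.disjoint_left.1 (hdisj j i hj) hk⟩
  have hterm : ∀ i, ρ i ^ s * d ^ s ≤ ∑ k ∈ S i, Metric.ediam (U k) ^ s := by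
    intro i
    have h1 := ih (S i) (hlt i) (fun k => K ∩ φ i ⁻¹' U k) (by
      intro x hx
      obtain ⟨k, hk, hxk⟩ := hcov i x hx
      exact Set.mem_iUnion₂.2 ⟨k, hk, hx, hxk⟩)
    calc ρ i ^ s * d ^ s ≤ ρ i ^ s * ∑ k ∈ S i, Metric.ediam (K ∩ φ i ⁻¹' U k) ^ s := by gcongr
      _ = ∑ k ∈ S i, (ρ i * Metric.ediam (K ∩ φ i ⁻¹' U k)) ^ s := by
          rw [Finset.mul_sum]
          exact Finset.sum_congr rfl fun k _ => (ENNReal.mul_rpow_of_nonneg _ _ hs).symm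
      _ ≤ _ := by
          refine Finset.sum_le_sum fun k _ => ENNReal.rpow_le_rpow ?_ hs
          rw [mul_comm]
          refine ENNReal.mul_le_of_le_div (Metric.ediam_le fun x hx y hy => ?_)
          rw [ENNReal.le_div_iff_mul_le (Or.inl (hρ₀ i)) (Or.inl (hρ' i)), mul_comm]
          exact (hρ i x hx.1 y hy.1).trans (Metric.edist_le_ediam_of_mem hx.2 hy.2)
  calc d ^ s = 1 * d ^ s := (one_mul _).symm
    _ ≤ (∑ i, ρ i ^ s) * d ^ s := by gcongr
    _ = ∑ i, ρ i ^ s * d ^ s := Finset.sum_mul ..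
    _ ≤ ∑ i, ∑ k ∈ S i, Metric.ediam (U k) ^ s := Finset.sum_le_sum fun i _ => hterm i
    _ = ∑ k ∈ Finset.univ.biUnion S, Metric.ediam (U k) ^ s :=
        (Finset.sum_biUnion fun i _ j _ hij => hdisj i j hij).symm
    _ ≤ _ := Finset.sum_le_sum_of_subset
        (Finset.biUnion_subset.2 fun i _ => Finset.filter_subset _ _)

theorem exists_open_superset_ediam_rpow_le {X : Type*} [PseudoEMetricSpace X] (t : Set X)
    {s : ℝ} (hs : 0 < s) {ε : ENNReal} (hε : ε ≠ 0) (ht : Metric.ediam t ≠ ⊤) :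
    ∃ U, t ⊆ U ∧ IsOpen U ∧
      Metric.ediam U ^ s ≤ (⨆ _ : t.Nonempty, Metric.ediam t ^ s) + ε := by
  rcases t.eq_empty_or_nonempty with rfl | hne
  · exact ⟨∅, subset_rfl, isOpen_empty, by simp [hs]⟩
  simp only [hne, ciSup_unique]
  have hcont : Tendsto (fun δ : NNReal => (Metric.ediam t + 2 * (δ : ENNReal)) ^ s) (𝓝 0)
      (𝓝 (Metric.ediam t ^ s)) := by
    have : Continuous fun δ : NNReal => (Metric.ediam t + 2 * (δ : ENNReal)) ^ s := by
      refine ENNReal.continuous_rpow_const.comp (continuous_const.add ?_)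
      exact (ENNReal.continuous_const_mul (by simp)).comp ENNReal.continuous_coe
    simpa using this.tendsto 0
  have hlt : Metric.ediam t ^ s < Metric.ediam t ^ s + ε :=
    ENNReal.lt_add_right (ENNReal.rpow_ne_top_of_nonneg hs.le ht) hε
  have h0 : ∀ᶠ δ : NNReal in 𝓝[>] 0, (Metric.ediam t + 2 * (δ : ENNReal)) ^ s <
      Metric.ediam t ^ s + ε := (hcont.eventually (gt_mem_nhds hlt)).filter_mono nhdsWithin_le_nhds
  obtain ⟨δ, hδ, hδ0⟩ := (h0.and self_mem_nhdsWithin).exists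
  refine ⟨Metric.thickening δ t, Metric.self_subset_thickening (by exact_mod_cast hδ0) t,
    Metric.isOpen_thickening, le_trans ?_ hδ.le⟩
  exact ENNReal.rpow_le_rpow (Metric.ediam_thickening_le δ) hs.le

/-- A countable cover of small `s`-sum can be enlarged to open sets at arbitrarily small total cost,
and compactness then extracts a finite cover. -/
theorem hausdorffMeasure_ne_zero_of_finite_cover {X : Type*} [EMetricSpace X] [MeasurableSpace X]
    [BorelSpace X] {K : Set X} (hK : IsCompact K) {s : ℝ} (hs : 0 < s) {c : ENNReal} (hc : c ≠ 0)
    (h : ∀ (T : Finset ℕ) (U : ℕ → Set X), K ⊆ ⋃ k ∈ T, U k →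
      c ≤ ∑ k ∈ T, Metric.ediam (U k) ^ s) : MeasureTheory.Measure.hausdorffMeasure s K ≠ 0 := by
  intro h0
  rw [MeasureTheory.Measure.hausdorffMeasure_apply] at h0
  -- The measure is a supremum over scales, so its vanishing already gives cheap covers at scale 1.
  have h1 := le_iSup₂ (f := fun (r : ENNReal) (_ : 0 < r) =>
    ⨅ (t : ℕ → Set X) (_ : K ⊆ ⋃ n, t n) (_ : ∀ n, Metric.ediam (t n) ≤ r),
      ∑' n, ⨆ _ : (t n).Nonempty, Metric.ediam (t n) ^ s) 1 zero_lt_one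
  rw [h0] at h1
  obtain ⟨e, he0, hec⟩ := exists_between (pos_iff_ne_zero.2 hc)
  obtain ⟨e', he'0, he'⟩ := exists_between (tsub_pos_iff_lt.2 hec)
  have h2 := h1.trans_lt he0
  simp only [iInf_lt_iff] at h2
  obtain ⟨t, hKt, hdt, hsum⟩ := h2
  obtain ⟨η, hη, hηs⟩ := ENNReal.exists_pos_sum_of_countable' he'0.ne' ℕ
  choose U htU hUo hU using fun n => exists_open_superset_ediam_rpow_le (t n) hs (hη n).ne'
    ((hdt n).trans_lt ENNReal.one_lt_top).ne
  obtain ⟨T, hT⟩ := hK.elim_finite_subcover U hUo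
    (hKt.trans (Set.iUnion_mono htU))
  have := calc c ≤ ∑ k ∈ T, Metric.ediam (U k) ^ s := h T U hT
    _ ≤ ∑' k, Metric.ediam (U k) ^ s := ENNReal.sum_le_tsum T
    _ ≤ ∑' k, ((⨆ _ : (t k).Nonempty, Metric.ediam (t k) ^ s) + η k) := ENNReal.tsum_le_tsum hU
    _ = _ := ENNReal.tsum_add
    _ ≤ e + e' := add_le_add hsum.le hηs.le
    _ < c := by
      rw [add_comm]
      exact lt_tsub_iff_right.1 he'
  exact lt_irrefl _ this


/-! ### Iterating the continued fraction maps. -/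

/-- `K` is invariant under the continued fraction maps `x ↦ 1 / (a + x)` for `a ∈ A`. -/
structure IsLimitSet (A : Finset ℕ) (K : Set ℝ) : Prop where
  two_le : ∀ a ∈ A, 2 ≤ a
  subset : K ⊆ Set.Icc 0 (1 / 2)
  mem : ∀ a ∈ A, ∀ x ∈ K, 1 / ((a : ℝ) + x) ∈ K
  exists_eq : ∀ y ∈ K, ∃ a ∈ A, ∃ x ∈ K, y = 1 / ((a : ℝ) + x)

/-- A finite family of compositions of continued fraction maps covering `K`; the `i`-th one has
derivative `± 1 / (q i + r i * x) ^ 2`. -/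
structure IsIterate (K : Set ℝ) (n : ℕ) {ι : Type} (φ : ι → ℝ → ℝ) (q r : ι → ℝ) : Prop where
  mem_Icc : ∀ i, ∀ x ∈ Set.Icc (0 : ℝ) (1 / 2), φ i x ∈ Set.Icc (0 : ℝ) (1 / 2)
  mapsTo : ∀ i, Set.MapsTo (φ i) K K
  cover : K ⊆ ⋃ i, φ i '' K
  dist_eq : ∀ i, ∀ x ∈ Set.Icc (0 : ℝ) (1 / 2), ∀ y ∈ Set.Icc (0 : ℝ) (1 / 2),
    |φ i x - φ i y| = |x - y| / ((q i + r i * x) * (q i + r i * y))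
  nonneg : ∀ i, 0 ≤ r i
  le : ∀ i, r i ≤ q i
  two_pow_le : ∀ i, 2 ^ n ≤ q i
  gap : ∀ i j, i ≠ j → ∃ d > 0, ∀ x ∈ Set.Icc (0 : ℝ) (1 / 2), ∀ y ∈ Set.Icc (0 : ℝ) (1 / 2),
    d ≤ |φ i x - φ j y|

theorem abs_one_div_add_sub {a x y : ℝ} (ha : 2 ≤ a) (hx : 0 ≤ x) (hy : 0 ≤ y) :
    |1 / (a + x) - 1 / (a + y)| = |x - y| / ((a + x) * (a + y)) := by
  have h1 : 0 < a + x := by linarith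
  have h2 : 0 < a + y := by linarith
  rw [div_sub_div _ _ h1.ne' h2.ne', abs_div, abs_of_pos (mul_pos h1 h2), ← abs_neg]
  congr 2
  ring

theorem gap_one_div_add {a b : ℕ} (ha : 2 ≤ a) (hb : 2 ≤ b) (hab : a ≠ b) :
    ∃ d > 0, ∀ x ∈ Set.Icc (0 : ℝ) (1 / 2), ∀ y ∈ Set.Icc (0 : ℝ) (1 / 2),
      d ≤ |1 / ((a : ℝ) + x) - 1 / ((b : ℝ) + y)| := by
  refine ⟨1 / 2 / (((a : ℝ) + 1) * (b + 1)), by positivity, fun x hx y hy => ?_⟩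
  obtain ⟨hx0, hx1⟩ := hx
  obtain ⟨hy0, hy1⟩ := hy
  have h1 : 0 < (a : ℝ) + x := by positivity
  have h2 : 0 < (b : ℝ) + y := by positivity
  rw [div_sub_div _ _ h1.ne' h2.ne', abs_div, abs_of_pos (mul_pos h1 h2)]
  have hnum : 1 / 2 ≤ |1 * ((b : ℝ) + y) - (a + x) * 1| := by
    rcases lt_or_gt_of_ne hab with h | h
    · have : (a : ℝ) + 1 ≤ b := by exact_mod_cast h
      exact le_abs.2 (Or.inl (by linarith))
    · have : (b : ℝ) + 1 ≤ a := by exact_mod_cast h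
      exact le_abs.2 (Or.inr (by linarith))
  gcongr <;> linarith

/-- The new map is composed on the inside, so denominators multiply by the chain rule and each
inequality for the operator iterates to its `n`-th power. One family serves all exponents and test
functions. -/
theorem exists_isIterate {A : Finset ℕ} {K : Set ℝ} (hK : IsLimitSet A K) (n : ℕ) :
    ∃ (ι : Type) (_ : Fintype ι) (φ : ι → ℝ → ℝ) (q r : ι → ℝ), IsIterate K n φ q r ∧
      ∀ (p c : ℝ) (f : ℝ → ℝ), 0 ≤ c →
        ((∀ x ∈ Set.Icc (0 : ℝ) (1 / 2),
            c * f x ≤ ∑ a ∈ A, (1 / ((a : ℝ) + x)) ^ p * f (1 / ((a : ℝ) + x))) →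
          ∀ x ∈ Set.Icc (0 : ℝ) (1 / 2),
            c ^ n * f x ≤ ∑ i, (1 / (q i + r i * x)) ^ p * f (φ i x)) ∧
        ((∀ x ∈ Set.Icc (0 : ℝ) (1 / 2),
            ∑ a ∈ A, (1 / ((a : ℝ) + x)) ^ p * f (1 / ((a : ℝ) + x)) ≤ c * f x) →
          ∀ x ∈ Set.Icc (0 : ℝ) (1 / 2),
            ∑ i, (1 / (q i + r i * x)) ^ p * f (φ i x) ≤ c ^ n * f x) := by
  induction n with
  | zero =>
    refine ⟨Unit, inferInstance, fun _ x => x, fun _ => 1, fun _ => 0,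
      ⟨fun _ _ h => h, fun _ _ h => h, fun x hx => by simpa using hx, by simp, by simp, by simp,
        by simp, fun i j h => (h rfl).elim⟩, fun p c f _ => ⟨by simp, by simp⟩⟩
  | succ n ih =>
    obtain ⟨ι, _, φ, q, r, hI, hsum⟩ := ih
    have hmem : ∀ a ∈ A, ∀ x ∈ Set.Icc (0 : ℝ) (1 / 2),
        1 / ((a : ℝ) + x) ∈ Set.Icc (0 : ℝ) (1 / 2) := fun a ha x hx =>
      one_div_add_mem (by exact_mod_cast hK.two_le a ha) hx.1
    have htwo : ∀ a : A, (2 : ℝ) ≤ (a : ℕ) := fun a => by exact_mod_cast hK.two_le a a.2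
    have hqpos : ∀ i, 0 < q i := fun i => (by positivity : (0 : ℝ) < 2 ^ n).trans_le (hI.two_pow_le i)
    -- The continuant recursion `(q, r) ↦ (q * a + r, q)` as a cocycle identity.
    have hden : ∀ i (a : A) (x : ℝ), 0 ≤ x →
        (q i * (a : ℕ) + r i) + q i * x = (((a : ℕ) : ℝ) + x) * (q i + r i * (1 / ((a : ℕ) + x))) := by
      intro i a x hx
      have : ((a : ℕ) : ℝ) + x ≠ 0 := by linarith [htwo a]
      field_simp
      ring
    have hexp : ∀ (p : ℝ) (f : ℝ → ℝ), ∀ x ∈ Set.Icc (0 : ℝ) (1 / 2),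
        ∑ i : ι × A, (1 / ((q i.1 * (i.2 : ℕ) + r i.1) + q i.1 * x)) ^ p *
          f (φ i.1 (1 / (((i.2 : ℕ) : ℝ) + x))) =
        ∑ a ∈ A, (1 / ((a : ℝ) + x)) ^ p *
          ∑ i, (1 / (q i + r i * (1 / ((a : ℝ) + x)))) ^ p * f (φ i (1 / ((a : ℝ) + x))) := by
      intro p f x hx
      rw [Fintype.sum_prod_type_right, ← Finset.sum_coe_sort A]
      refine Finset.sum_congr rfl fun a _ => ?_
      rw [Finset.mul_sum]
      refine Finset.sum_congr rfl fun i _ => ?_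
      have h1 : 0 ≤ 1 / (((a : ℕ) : ℝ) + x) := (hmem a a.2 x hx).1
      have h2 : 0 ≤ q i + r i * (1 / (((a : ℕ) : ℝ) + x)) :=
        add_nonneg (hqpos i).le (mul_nonneg (hI.nonneg i) h1)
      rw [← mul_assoc, ← Real.mul_rpow h1 (one_div_nonneg.2 h2), one_div_mul_one_div, hden i a x hx.1]
    refine ⟨ι × A, inferInstance, fun i x => φ i.1 (1 / ((i.2 : ℕ) + x)),
      fun i => q i.1 * (i.2 : ℕ) + r i.1, fun i => q i.1, ⟨?_, ?_, ?_, ?_, ?_, ?_, ?_, ?_⟩, ?_⟩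
    · exact fun i x hx => hI.mem_Icc _ _ (hmem _ i.2.2 x hx)
    · exact fun i x hx => hI.mapsTo _ (hK.mem _ i.2.2 x hx)
    · intro y hy
      obtain ⟨i, x, hx, rfl⟩ := Set.mem_iUnion.1 (hI.cover hy)
      obtain ⟨a, ha, z, hz, rfl⟩ := hK.exists_eq x hx
      exact Set.mem_iUnion.2 ⟨(i, ⟨a, ha⟩), z, hz, rfl⟩
    · rintro ⟨i, a⟩ x hx y hy
      simp only
      rw [hI.dist_eq _ _ (hmem a a.2 x hx) _ (hmem a a.2 y hy),
        abs_one_div_add_sub (htwo a) hx.1 hy.1, hden i a x hx.1, hden i a y hy.1, div_div]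
      congr 1
      ring
    · exact fun i => (hqpos i.1).le
    · rintro ⟨i, a⟩
      nlinarith [hqpos i, hI.nonneg i, htwo a]
    · rintro ⟨i, a⟩
      have := hI.two_pow_le i
      simp only [pow_succ]
      nlinarith [hqpos i, hI.nonneg i, htwo a]
    · rintro ⟨i, a⟩ ⟨j, b⟩ hij
      -- Words differing only in the innermost letter: the gap of the two letters is shrunk by at
      -- most `(2 * q i) ^ 2`. Otherwise the gap of the outer words applies.
      by_cases h : i = j
      · subst h
        have hab : (a : ℕ) ≠ b := fun h => hij (by rw [Subtype.ext h])
        obtain ⟨d, hd, hgap⟩ := gap_one_div_add (hK.two_le a a.2) (hK.two_le b b.2) hab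
        have hq := hqpos i
        refine ⟨d / ((2 * q i) * (2 * q i)), by positivity, fun x hx y hy => ?_⟩
        simp only
        have hx' := hmem a a.2 x hx
        have hy' := hmem b b.2 y hy
        rw [hI.dist_eq _ _ hx' _ hy']
        have key : ∀ z ∈ Set.Icc (0 : ℝ) (1 / 2), 0 < q i + r i * z ∧ q i + r i * z ≤ 2 * q i := by
          intro z hz
          have := hI.nonneg i
          have := hI.le i
          exact ⟨by nlinarith [hz.1], by nlinarith [hz.1, hz.2]⟩
        exact div_le_div₀ (abs_nonneg _) (hgap x hx y hy) (mul_pos (key _ hx').1 (key _ hy').1)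
          (mul_le_mul (key _ hx').2 (key _ hy').2 (key _ hy').1.le (by positivity))
      · obtain ⟨d, hd, hgap⟩ := hI.gap i j h
        exact ⟨d, hd, fun x hx y hy => hgap _ (hmem a a.2 x hx) _ (hmem b b.2 y hy)⟩
    · intro p c f hc
      constructor
      · intro h x hx
        refine le_trans ?_ (hexp p f x hx).ge
        calc c ^ (n + 1) * f x = c ^ n * (c * f x) := by ring
          _ ≤ c ^ n * ∑ a ∈ A, (1 / ((a : ℝ) + x)) ^ p * f (1 / ((a : ℝ) + x)) := by
            gcongr
            exact h x hx
          _ = ∑ a ∈ A, (1 / ((a : ℝ) + x)) ^ p * (c ^ n * f (1 / ((a : ℝ) + x))) := by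
            rw [Finset.mul_sum]
            exact Finset.sum_congr rfl fun _ _ => by ring
          _ ≤ _ := by
            refine Finset.sum_le_sum fun a ha => mul_le_mul_of_nonneg_left ?_
              (Real.rpow_nonneg (hmem a ha x hx).1 _)
            exact (hsum p c f hc).1 h _ (hmem a ha x hx)
      · intro h x hx
        refine (hexp p f x hx).le.trans ?_
        calc _ ≤ ∑ a ∈ A, (1 / ((a : ℝ) + x)) ^ p * (c ^ n * f (1 / ((a : ℝ) + x))) := by
              refine Finset.sum_le_sum fun a ha => mul_le_mul_of_nonneg_left ?_
                (Real.rpow_nonneg (hmem a ha x hx).1 _)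
              exact (hsum p c f hc).2 h _ (hmem a ha x hx)
          _ = c ^ n * ∑ a ∈ A, (1 / ((a : ℝ) + x)) ^ p * f (1 / ((a : ℝ) + x)) := by
            rw [Finset.mul_sum]
            exact Finset.sum_congr rfl fun _ _ => by ring
          _ ≤ c ^ n * (c * f x) := by
            gcongr
            exact h x hx
          _ = c ^ (n + 1) * f x := by ring


/-! ### From transfer inequalities to dimension bounds. -/

theorem dimH_le_of_transfer {A : Finset ℕ} {K : Set ℝ} (hK : IsLimitSet A K) {s m : ℝ} (hs : 0 ≤ s)
    (hm : 0 < m) (f : ℝ → ℝ) (hf : ∀ x ∈ Set.Icc (0 : ℝ) (1 / 2), m ≤ f x)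
    (h : ∀ x ∈ Set.Icc (0 : ℝ) (1 / 2),
      ∑ a ∈ A, (1 / ((a : ℝ) + x)) ^ (2 * s) * f (1 / ((a : ℝ) + x)) ≤ f x) :
    dimH K ≤ ENNReal.ofReal s := by
  choose ι hι φ q r hI hsum using exists_isIterate hK
  have h0 : (0 : ℝ) ∈ Set.Icc (0 : ℝ) (1 / 2) := by norm_num
  have hqpos : ∀ n i, 0 < q n i := fun n i =>
    (by positivity : (0 : ℝ) < 2 ^ n).trans_le ((hI n).two_pow_le i)
  have hdiam : ∀ n i, Metric.ediam (φ n i '' K) ≤ ENNReal.ofReal ((1 / q n i) ^ 2) := by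
    intro n i
    refine Metric.ediam_le ?_
    rintro _ ⟨x, hx, rfl⟩ _ ⟨y, hy, rfl⟩
    have hx := hK.subset hx
    have hy := hK.subset hy
    rw [edist_dist, Real.dist_eq, (hI n).dist_eq i x hx y hy]
    refine ENNReal.ofReal_le_ofReal ?_
    have hr := (hI n).nonneg i
    have hq := hqpos n i
    rw [one_div, inv_pow, ← one_div, sq]
    have := mul_nonneg hr hx.1
    have := mul_nonneg hr hy.1
    have : |x - y| ≤ 1 := abs_le.2 ⟨by linarith [hx.1, hy.2], by linarith [hx.2, hy.1]⟩
    gcongr <;> linarith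
  have hmeas : MeasureTheory.Measure.hausdorffMeasure s K ≤ ENNReal.ofReal (f 0 / m) := by
    refine (MeasureTheory.Measure.hausdorffMeasure_le_liminf_sum (l := atTop) s K
      (fun n => ENNReal.ofReal ((1 / 2) ^ n)) ?_ (fun n i => φ n i '' K)
      (Eventually.of_forall fun n i => (hdiam n i).trans (ENNReal.ofReal_le_ofReal ?_))
      (Eventually.of_forall fun n => (hI n).cover)).trans ?_
    · rw [← ENNReal.ofReal_zero]
      exact ENNReal.tendsto_ofReal (tendsto_pow_atTop_nhds_zero_of_lt_one (by norm_num) (by norm_num))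
    · have h1 : 1 / q n i ≤ (1 / 2) ^ n := by
        rw [one_div_pow]
        exact one_div_le_one_div_of_le (by positivity) ((hI n).two_pow_le i)
      have h2 : (1 / 2 : ℝ) ^ n ≤ 1 := pow_le_one₀ (by norm_num) (by norm_num)
      have h3 : 0 ≤ 1 / q n i := one_div_nonneg.2 (hqpos n i).le
      nlinarith
    · refine (liminf_le_liminf (v := fun _ => ENNReal.ofReal (f 0 / m)) (Eventually.of_forall fun n => ?_)).trans
        (by simp)
      -- At `x = 0` the weights are exactly `(1 / q) ^ (2 * s)`, which dominate `diam ^ s`; hence a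
      -- bound uniform in `n`.
      have hn := (hsum n (2 * s) 1 f zero_le_one).2 (by simpa using h) 0 h0
      simp only [mul_zero, add_zero, one_pow, one_mul] at hn
      have hpos : ∀ i, 0 ≤ (1 / q n i) ^ (2 * s) := fun i =>
        Real.rpow_nonneg (one_div_nonneg.2 (hqpos n i).le) _
      calc ∑ i, Metric.ediam (φ n i '' K) ^ s ≤ ∑ i, ENNReal.ofReal ((1 / q n i) ^ (2 * s)) := by
            refine Finset.sum_le_sum fun i _ => ?_
            refine (ENNReal.rpow_le_rpow (hdiam n i) hs).trans (le_of_eq ?_)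
            rw [ENNReal.ofReal_rpow_of_nonneg (by positivity) hs, Real.rpow_mul
              (one_div_nonneg.2 (hqpos n i).le), Real.rpow_two]
        _ = ENNReal.ofReal (∑ i, (1 / q n i) ^ (2 * s)) :=
            (ENNReal.ofReal_sum_of_nonneg fun i _ => hpos i).symm
        _ ≤ _ := by
            refine ENNReal.ofReal_le_ofReal ?_
            rw [le_div_iff₀ hm, Finset.sum_mul]
            refine le_trans (Finset.sum_le_sum fun i _ => ?_) hn
            exact mul_le_mul_of_nonneg_left (hf _ ((hI n).mem_Icc i 0 h0)) (hpos i)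
  refine dimH_le_of_hausdorffMeasure_ne_top (d := s.toNNReal) ?_
  rw [Real.coe_toNNReal s hs]
  exact ne_top_of_le_ne_top ENNReal.ofReal_ne_top hmeas

theorem le_dimH_of_transfer {A : Finset ℕ} {K : Set ℝ} (hK : IsLimitSet A K) (hcpt : IsCompact K)
    (hne : K.Nonempty) {s c : ℝ} (hs : 0 < s) (hc : 1 < c) (f : ℝ → ℝ) (hf₀ : 0 < f 0)
    (hf : ∀ x ∈ Set.Icc (0 : ℝ) (1 / 2), f x ≤ 1)
    (h : ∀ x ∈ Set.Icc (0 : ℝ) (1 / 2),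
      c * f x ≤ ∑ a ∈ A, (1 / ((a : ℝ) + x)) ^ (2 * s) * f (1 / ((a : ℝ) + x))) :
    ENNReal.ofReal s ≤ dimH K := by
  have h0 : (0 : ℝ) ∈ Set.Icc (0 : ℝ) (1 / 2) := by norm_num
  -- The denominators `q + r * x` lie between `q` and `2 * q`, so `(1 / (2 * q)) ^ 2` is a lower
  -- contraction ratio. The factor `(1 / 2) ^ (2 * s)` thus lost does not depend on `n`, and `c ^ n`
  -- absorbs it.
  obtain ⟨n, hn⟩ := pow_unbounded_of_one_lt (1 / ((1 / 2) ^ (2 * s) * f 0)) hc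
  have hhalf : (0 : ℝ) < (1 / 2) ^ (2 * s) := by positivity
  rw [div_lt_iff₀ (by positivity)] at hn
  obtain ⟨ι, _, φ, q, r, hI, hsum⟩ := exists_isIterate hK n
  have hqpos : ∀ i, 0 < q i := fun i =>
    (by positivity : (0 : ℝ) < 2 ^ n).trans_le (hI.two_pow_le i)
  have hρpos : ∀ i, 0 < (1 / (2 * q i)) ^ 2 := fun i => by have := hqpos i; positivity
  have hsum1 : 1 ≤ ∑ i, ((1 / (2 * q i)) ^ 2) ^ s := by
    have h1 := (hsum (2 * s) c f (by linarith)).1 h 0 h0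
    simp only [mul_zero, add_zero] at h1
    calc 1 ≤ (1 / 2) ^ (2 * s) * (c ^ n * f 0) := by linarith
      _ ≤ (1 / 2) ^ (2 * s) * ∑ i, (1 / q i) ^ (2 * s) * f (φ i 0) := by gcongr
      _ ≤ (1 / 2) ^ (2 * s) * ∑ i, (1 / q i) ^ (2 * s) := by
          gcongr with i
          exact mul_le_of_le_one_right (Real.rpow_nonneg (one_div_nonneg.2 (hqpos i).le) _)
            (hf _ (hI.mem_Icc i 0 h0))
      _ = _ := by
          rw [Finset.mul_sum]
          refine Finset.sum_congr rfl fun i _ => ?_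
          have := one_div_nonneg.2 (hqpos i).le
          rw [← Real.mul_rpow (by norm_num) this, one_div_mul_one_div, Real.rpow_mul
            (by have := hqpos i; positivity), Real.rpow_two]
  -- No map, or a single one with ratio below 1, would make the sum less than 1.
  have hnontriv : Nontrivial ι := by
    by_contra hsub
    rw [not_nontrivial_iff_subsingleton] at hsub
    rcases isEmpty_or_nonempty ι with hemp | ⟨⟨i⟩⟩
    · simp at hsum1
      linarith
    · have huniv : (Finset.univ : Finset ι) = {i} := by
        ext j
        simp [Subsingleton.elim j i]
      rw [huniv, Finset.sum_singleton] at hsum1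
      have h1 : (1 : ℝ) ≤ q i := (one_le_pow₀ (by norm_num)).trans (hI.two_pow_le i)
      have h2 : 1 / (2 * q i) < 1 := by
        rw [div_lt_one (by linarith)]
        linarith
      have h3 : 0 ≤ 1 / (2 * q i) := by have := hqpos i; positivity
      exact absurd (Real.rpow_lt_one (sq_nonneg _) (pow_lt_one₀ h3 h2 two_ne_zero) hs) (not_lt.2 hsum1)
  choose! D hD hgap using hI.gap
  have hex : ∃ d > 0, ∀ i j, i ≠ j → d ≤ D i j := by
    have hev : ∀ᶠ d in 𝓝[>] (0 : ℝ), ∀ i j, i ≠ j → d ≤ D i j := by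
      refine eventually_all.2 fun i => eventually_all.2 fun j => eventually_imp_distrib_left.2 fun hij => ?_
      exact (eventually_le_nhds (hD i j hij)).filter_mono nhdsWithin_le_nhds
    obtain ⟨d, hd, hd0⟩ := (hev.and self_mem_nhdsWithin).exists
    exact ⟨d, hd0, hd⟩
  obtain ⟨d, hd0, hd⟩ := hex
  refine le_dimH_of_hausdorffMeasure_ne_zero (d := s.toNNReal) ?_
  rw [Real.coe_toNNReal s hs.le]
  refine hausdorffMeasure_ne_zero_of_finite_cover hcpt hs (c := ENNReal.ofReal d ^ s)
    (ENNReal.rpow_pos (ENNReal.ofReal_pos.2 hd0) ENNReal.ofReal_ne_top).ne' fun T U hU => ?_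
  refine rpow_le_sum_ediam_rpow hne hI.mapsTo (ρ := fun i => ENNReal.ofReal ((1 / (2 * q i)) ^ 2))
    ?_ (fun i => (ENNReal.ofReal_pos.2 (hρpos i)).ne') (fun i => ENNReal.ofReal_ne_top) ?_ hs.le ?_ T U hU
  · intro i x hx y hy
    have hx := hK.subset hx
    have hy := hK.subset hy
    rw [edist_dist, edist_dist, ← ENNReal.ofReal_mul (hρpos i).le, Real.dist_eq, Real.dist_eq,
      hI.dist_eq i x hx y hy]
    refine ENNReal.ofReal_le_ofReal ?_
    have key : ∀ z ∈ Set.Icc (0 : ℝ) (1 / 2), 0 < q i + r i * z ∧ q i + r i * z ≤ 2 * q i := by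
      intro z hz
      have := hI.nonneg i
      have := hI.le i
      have := hqpos i
      exact ⟨by nlinarith [hz.1], by nlinarith [hz.1, hz.2]⟩
    rw [one_div_pow, one_div_mul_eq_div, sq]
    exact div_le_div_of_nonneg_left (abs_nonneg _) (mul_pos (key _ hx).1 (key _ hy).1)
      (mul_le_mul (key _ hx).2 (key _ hy).2 (key _ hy).1.le (by have := hqpos i; positivity))
  · intro i j hij x hx y hy
    rw [edist_dist, Real.dist_eq]
    exact ENNReal.ofReal_le_ofReal
      ((hd i j hij).trans (hgap i j hij x (hK.subset hx) y (hK.subset hy)))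
  · rw [← ENNReal.ofReal_one]
    refine (ENNReal.ofReal_le_ofReal hsum1).trans (le_of_eq ?_)
    rw [ENNReal.ofReal_sum_of_nonneg fun i _ => Real.rpow_nonneg (hρpos i).le _]
    exact Finset.sum_congr rfl fun i _ => (ENNReal.ofReal_rpow_of_nonneg (hρpos i).le hs.le).symm


/-! ### Convergence of continued fractions and compactness of the limit set. -/

/-- The finite continued fraction `[a 0, …, a (k - 1)]`, evaluated from the inside. -/
def finiteContFrac {K : Type*} [Field K] : (ℕ → ℕ) → ℕ → K
  | _, 0 => 0
  | a, k + 1 => 1 / ((a 0 : K) + finiteContFrac (fun j => a (j + 1)) k)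

theorem convs_contFrac {K : Type*} [Field K] [LinearOrder K] [IsStrictOrderedRing K] (a : ℕ → ℕ)
    (ha : ∀ j, 0 < a j) (k : ℕ) : (contFrac K a).convs k = finiteContFrac a k := by
  rw [GenContFract.convs_eq_convs']
  · simp only [contFrac, GenContFract.convs', zero_add]
    clear ha
    induction k generalizing a with
    | zero => rfl
    | succ k ih =>
      rw [GenContFract.convs'Aux_succ_some (p := ⟨1, (a 0 : K)⟩) rfl, finiteContFrac, ← ih]
      rfl
  · intro gp m _ hgp
    have : gp = ⟨1, (a m : K)⟩ := (Option.some_injective _ hgp).symm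
    subst this
    exact ⟨one_pos, Nat.cast_pos.2 (ha m)⟩

theorem finiteContFrac_mem {a : ℕ → ℕ} (ha : ∀ j, 2 ≤ a j) (k : ℕ) :
    (finiteContFrac a k : ℝ) ∈ Set.Icc (0 : ℝ) (1 / 2) := by
  induction k generalizing a with
  | zero => norm_num [finiteContFrac]
  | succ k ih =>
    exact one_div_add_mem (by exact_mod_cast ha 0) (ih fun j => ha (j + 1)).1

/-- Each outer step divides distances by `(a 0 + x) * (a 0 + y) ≥ 4`. The rate is uniform in `a`,
which makes the value continuous on sequences and the limit set compact. -/
theorem abs_finiteContFrac_sub_le {a : ℕ → ℕ} (ha : ∀ j, 2 ≤ a j) (k m : ℕ) :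
    |(finiteContFrac a k : ℝ) - finiteContFrac a (k + m)| ≤ (1 / 4) ^ k := by
  induction k generalizing a with
  | zero =>
    have := finiteContFrac_mem ha (0 + m)
    have h0 : (finiteContFrac a 0 : ℝ) = 0 := rfl
    rw [h0, zero_sub, abs_neg, abs_of_nonneg this.1]
    linarith [this.2]
  | succ k ih =>
    have h2 : (2 : ℝ) ≤ a 0 := by exact_mod_cast ha 0
    rw [Nat.add_right_comm k 1 m, finiteContFrac, finiteContFrac,
      abs_one_div_add_sub h2 (finiteContFrac_mem (fun j => ha (j + 1)) _).1
        (finiteContFrac_mem (fun j => ha (j + 1)) _).1, div_le_iff₀]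
    · have h := ih fun j => ha (j + 1)
      have hx := (finiteContFrac_mem (fun j => ha (j + 1)) k).1
      have hy := (finiteContFrac_mem (fun j => ha (j + 1)) (k + m)).1
      refine h.trans ?_
      rw [pow_succ, mul_assoc]
      refine le_mul_of_one_le_right (by positivity) ?_
      nlinarith
    · have hx := (finiteContFrac_mem (fun j => ha (j + 1)) k).1
      have hy := (finiteContFrac_mem (fun j => ha (j + 1)) (k + m)).1
      positivity

/-- The value of an infinite continued fraction. -/
noncomputable def contFracValue (a : ℕ → ℕ) : ℝ := limUnder atTop (finiteContFrac (K := ℝ) a)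

theorem tendsto_finiteContFrac {a : ℕ → ℕ} (ha : ∀ j, 2 ≤ a j) :
    Tendsto (finiteContFrac (K := ℝ) a) atTop (𝓝 (contFracValue a)) := by
  refine CauchySeq.tendsto_limUnder (cauchySeq_of_le_geometric (1 / 4) 1 (by norm_num) fun n => ?_)
  rw [Real.dist_eq, one_mul]
  exact abs_finiteContFrac_sub_le ha n 1

theorem contFracValue_mem {a : ℕ → ℕ} (ha : ∀ j, 2 ≤ a j) :
    contFracValue a ∈ Set.Icc (0 : ℝ) (1 / 2) :=
  isClosed_Icc.mem_of_tendsto (tendsto_finiteContFrac ha)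
    (Eventually.of_forall (finiteContFrac_mem ha))

theorem abs_finiteContFrac_sub_value_le {a : ℕ → ℕ} (ha : ∀ j, 2 ≤ a j) (k : ℕ) :
    |(finiteContFrac a k : ℝ) - contFracValue a| ≤ (1 / 4) ^ k := by
  have h := (tendsto_finiteContFrac ha).comp (tendsto_add_atTop_nat k)
  refine le_of_tendsto ((tendsto_const_nhds.sub h).abs) (Eventually.of_forall fun m => ?_)
  simp only [Function.comp, add_comm m k]
  exact abs_finiteContFrac_sub_le ha k m

theorem contFracValue_eq {a : ℕ → ℕ} (ha : ∀ j, 2 ≤ a j) :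
    contFracValue a = 1 / ((a 0 : ℝ) + contFracValue fun j => a (j + 1)) := by
  have h1 := (tendsto_finiteContFrac ha).comp (tendsto_add_atTop_nat 1)
  have hv := (contFracValue_mem fun j => ha (j + 1)).1
  have h2 : (2 : ℝ) ≤ a 0 := by exact_mod_cast ha 0
  refine tendsto_nhds_unique h1 ?_
  exact tendsto_const_nhds.div (tendsto_const_nhds.add (tendsto_finiteContFrac fun j => ha (j + 1)))
    (by linarith)

theorem continuous_finiteContFrac (A : Set ℕ) (hA : ∀ a ∈ A, 2 ≤ a) (k : ℕ) :
    ContinuousOn (fun a : ℕ → ℕ => (finiteContFrac a k : ℝ)) (Set.univ.pi fun _ => A) := by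
  induction k with
  | zero => exact continuousOn_const
  | succ k ih =>
    have hshift : Continuous fun (a : ℕ → ℕ) (j : ℕ) => a (j + 1) :=
      continuous_pi fun j => continuous_apply (j + 1)
    have hmaps : Set.MapsTo (fun (a : ℕ → ℕ) (j : ℕ) => a (j + 1)) (Set.univ.pi fun _ => A)
        (Set.univ.pi fun _ => A) := fun a ha j _ => ha (j + 1) trivial
    have h0 : Continuous fun a : ℕ → ℕ => ((a 0 : ℕ) : ℝ) :=
      continuous_of_discreteTopology.comp (continuous_apply 0)
    refine continuousOn_const.div (h0.continuousOn.add (ih.comp hshift.continuousOn hmaps)) ?_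
    intro a ha
    have h1 := (finiteContFrac_mem (a := fun j => a (j + 1)) (fun j => hA _ (ha (j + 1) trivial)) k).1
    have h2 : (2 : ℝ) ≤ a 0 := by exact_mod_cast hA _ (ha 0 trivial)
    exact (by linarith : (0 : ℝ) < _).ne'

theorem continuousOn_contFracValue (A : Set ℕ) (hA : ∀ a ∈ A, 2 ≤ a) :
    ContinuousOn contFracValue (Set.univ.pi fun _ => A) := by
  have hu : TendstoUniformlyOn (fun (k : ℕ) (a : ℕ → ℕ) => (finiteContFrac a k : ℝ)) contFracValue
      atTop (Set.univ.pi fun _ => A) := by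
    rw [Metric.tendstoUniformlyOn_iff]
    intro ε hε
    have := (tendsto_pow_atTop_nhds_zero_of_lt_one (r := (1 / 4 : ℝ)) (by norm_num)
      (by norm_num)).eventually (gt_mem_nhds hε)
    filter_upwards [this] with k hk a ha
    rw [dist_comm, Real.dist_eq]
    exact (abs_finiteContFrac_sub_value_le (fun j => hA _ (ha j trivial)) k).trans_lt hk
  exact hu.continuousOn (Frequently.of_forall fun k => continuous_finiteContFrac A hA k)

theorem cantorSet_eq_image (A : Set ℕ) (hA : ∀ a ∈ A, 2 ≤ a) :
    cantorSet A = contFracValue '' Set.univ.pi fun _ => A := by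
  ext x
  have key : ∀ a : ℕ → ℕ, (∀ j, a j ∈ A) →
      Tendsto (fun k => (contFrac ℝ a).convs k) atTop (𝓝 (contFracValue a)) := by
    intro a ha
    simp only [convs_contFrac (K := ℝ) a fun j => two_pos.trans_le (hA _ (ha j))]
    exact tendsto_finiteContFrac fun j => hA _ (ha j)
  constructor
  · rintro ⟨a, ha, hx⟩
    exact ⟨a, fun j _ => ha j, tendsto_nhds_unique (key a ha) hx⟩
  · rintro ⟨a, ha, rfl⟩
    exact ⟨a, fun j => ha j trivial, key a fun j => ha j trivial⟩

theorem isCompact_cantorSet (A : Finset ℕ) (hA : ∀ a ∈ A, 2 ≤ a) :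
    IsCompact (cantorSet (A : Set ℕ)) := by
  rw [cantorSet_eq_image _ hA]
  exact (isCompact_univ_pi fun _ => A.finite_toSet.isCompact).image_of_continuousOn
    (continuousOn_contFracValue _ hA)

theorem cantorSet_nonempty {A : Set ℕ} (hA : ∀ a ∈ A, 2 ≤ a) (hne : A.Nonempty) :
    (cantorSet A).Nonempty := by
  obtain ⟨a, ha⟩ := hne
  rw [cantorSet_eq_image A hA]
  exact ⟨_, fun _ => a, fun _ _ => ha, rfl⟩

theorem isLimitSet_cantorSet (A : Finset ℕ) (hA : ∀ a ∈ A, 2 ≤ a) :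
    IsLimitSet A (cantorSet (A : Set ℕ)) := by
  rw [cantorSet_eq_image _ hA]
  refine ⟨hA, ?_, ?_, ?_⟩
  · rintro _ ⟨a, ha, rfl⟩
    exact contFracValue_mem fun j => hA _ (ha j trivial)
  · rintro b hb _ ⟨a, ha, rfl⟩
    have hmem : ∀ j : ℕ, (Nat.casesOn j b a : ℕ) ∈ A := by
      rintro (_ | j)
      · exact hb
      · exact ha j trivial
    refine ⟨fun j => Nat.casesOn j b a, fun j _ => hmem j, ?_⟩
    exact contFracValue_eq fun j => hA _ (hmem j)
  · rintro _ ⟨a, ha, rfl⟩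
    exact ⟨a 0, ha 0 trivial, _, ⟨fun j => a (j + 1), fun j _ => ha _ trivial, rfl⟩,
      contFracValue_eq fun j => hA _ (ha j trivial)⟩


/-! ### The alphabet of even digits: dimension, residues modulo 4, conclusion. -/

theorem coe_evenFinset : (({2, 4, 6, 8, 10} : Finset ℕ) : Set ℕ) = evenAlphabet := by
  simp [evenAlphabet]

theorem two_le_of_mem_evenAlphabet {a : ℕ} (ha : a ∈ evenAlphabet) : 2 ≤ a := by
  rw [evenAlphabet] at ha
  simp only [Set.mem_insert_iff, Set.mem_singleton_iff] at ha
  omega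

theorem even_of_mem_evenAlphabet {a : ℕ} (ha : a ∈ evenAlphabet) : Even a := by
  rw [evenAlphabet] at ha
  simp only [Set.mem_insert_iff, Set.mem_singleton_iff] at ha
  rw [Nat.even_iff]
  omega

theorem dimH_cantorSet_evenAlphabet_le :
    dimH (cantorSet evenAlphabet) ≤ ENNReal.ofReal ((1 + 1 / 28) / 2) := by
  have hA : ∀ a ∈ ({2, 4, 6, 8, 10} : Finset ℕ), 2 ≤ a := by decide
  rw [← coe_evenFinset]
  refine dimH_le_of_transfer (isLimitSet_cantorSet _ hA) (by norm_num) one_half_pos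
    (fun x => 1 - 0.294 * x + 0.085 * x ^ 2) (fun x hx => (upperWeight_bounds hx.1 hx.2).1)
    fun x hx => ?_
  rw [mul_div_cancel₀ _ (two_ne_zero' ℝ)]
  exact upper_transfer hx.1 hx.2

theorem le_dimH_cantorSet_evenAlphabet :
    ENNReal.ofReal ((1 + 3 / 88) / 2) ≤ dimH (cantorSet evenAlphabet) := by
  have hA : ∀ a ∈ ({2, 4, 6, 8, 10} : Finset ℕ), 2 ≤ a := by decide
  rw [← coe_evenFinset]
  refine le_dimH_of_transfer (isLimitSet_cantorSet _ hA) (isCompact_cantorSet _ hA)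
    (cantorSet_nonempty hA ⟨2, by simp⟩) (by norm_num) (c := 1.0003) (by norm_num)
    (fun x => 1 - 0.288 * x + 0.075 * x ^ 2) (by norm_num)
    (fun x hx => (lowerWeight_bounds hx.1 hx.2).2) fun x hx => ?_
  rw [mul_div_cancel₀ _ (two_ne_zero' ℝ)]
  exact lower_transfer hx.1 hx.2

theorem rationals_evenAlphabet_eq : rationals evenAlphabet =
    {q | ∃ a : ℕ → ℕ, (∀ j, a j ∈ evenAlphabet) ∧ ∃ k, q = finiteContFrac a (k + 1)} := by
  ext q
  constructor
  · rintro ⟨a, ha, k, hk, rfl⟩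
    refine ⟨a, ha, k - 1, ?_⟩
    rw [Nat.sub_add_cancel hk]
    exact convs_contFrac a (fun j => two_pos.trans_le (two_le_of_mem_evenAlphabet (ha j))) k
  · rintro ⟨a, ha, k, rfl⟩
    exact ⟨a, ha, k + 1, Nat.le_add_left 1 k,
      (convs_contFrac a (fun j => two_pos.trans_le (two_le_of_mem_evenAlphabet (ha j))) _).symm⟩

/-- Convergents with even partial quotients are `2m / (4n + 1)` or `(4n + 1) / 2m`. -/
theorem finiteContFrac_eq_div {a : ℕ → ℕ} (ha : ∀ j, Even (a j)) (hpos : ∀ j, 0 < a j) (k : ℕ) :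
    ∃ u v : ℕ, u.Coprime v ∧ (finiteContFrac a (k + 1) : ℚ) = (u : ℚ) / v ∧
      ((∃ m n, 1 ≤ m ∧ u = 2 * m ∧ v = 4 * n + 1) ∨ ∃ m n, 1 ≤ m ∧ u = 4 * n + 1 ∧ v = 2 * m) := by
  induction k generalizing a with
  | zero =>
    obtain ⟨m, hm⟩ := ha 0
    refine ⟨1, a 0, Nat.coprime_one_left _, by simp [finiteContFrac], Or.inr ⟨m, 0, ?_, rfl, by omega⟩⟩
    have := hpos 0
    omega
  | succ k ih =>
    obtain ⟨u, v, hcop, heq, hform⟩ := ih (a := fun j => a (j + 1)) (fun j => ha _) fun j => hpos _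
    obtain ⟨b, hb⟩ := ha 0
    have hv : 0 < v := by
      rcases hform with ⟨m, n, hm, hu, hv⟩ | ⟨m, n, hm, hu, hv⟩ <;> omega
    refine ⟨v, a 0 * v + u, ?_, ?_, ?_⟩
    · rw [Nat.coprime_mul_right_add_right]
      exact hcop.symm
    · rw [finiteContFrac, heq]
      have : (v : ℚ) ≠ 0 := by exact_mod_cast hv.ne'
      push_cast
      field_simp
    · rcases hform with ⟨m, n, hm, rfl, rfl⟩ | ⟨m, n, hm, rfl, rfl⟩
      · exact Or.inr ⟨b * (4 * n + 1) + m, n, by omega, rfl, by rw [hb]; ring⟩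
      · exact Or.inl ⟨m, b * m + n, hm, rfl, by rw [hb]; ring⟩

theorem num_den_of_mem_rationals {q : ℚ} (hq : q ∈ rationals evenAlphabet) :
    (∃ m n : ℕ, 1 ≤ m ∧ q.num = 2 * (m : ℤ) ∧ q.den = 4 * n + 1) ∨
      (∃ m n : ℕ, 1 ≤ m ∧ q.num = 4 * (n : ℤ) + 1 ∧ q.den = 2 * m) := by
  rw [rationals_evenAlphabet_eq] at hq
  obtain ⟨a, ha, k, rfl⟩ := hq
  obtain ⟨u, v, hcop, heq, hform⟩ := finiteContFrac_eq_div
    (fun j => even_of_mem_evenAlphabet (ha j))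
    (fun j => two_pos.trans_le (two_le_of_mem_evenAlphabet (ha j))) k
  have hv : 0 < v := by
    rcases hform with ⟨m, n, hm, hu, hv⟩ | ⟨m, n, hm, hu, hv⟩ <;> omega
  have hnum : (finiteContFrac a (k + 1) : ℚ).num = u := by
    rw [heq]
    exact Rat.num_div_eq_of_coprime (a := u) (b := v) (by exact_mod_cast hv) hcop
  have hden : (finiteContFrac a (k + 1) : ℚ).den = v := by
    rw [heq]
    exact Int.ofNat_injective
      (Rat.den_div_eq_of_coprime (a := u) (b := v) (by exact_mod_cast hv) hcop)
  rw [hnum, hden]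
  rcases hform with ⟨m, n, hm, rfl, rfl⟩ | ⟨m, n, hm, rfl, rfl⟩
  · exact Or.inl ⟨m, n, hm, by push_cast; rfl, rfl⟩
  · exact Or.inr ⟨m, n, hm, by push_cast; rfl, rfl⟩

theorem mod_four_of_mem_denominators {d : ℕ} (hd : d ∈ denominators evenAlphabet) :
    d % 4 ≠ 3 := by
  obtain ⟨q, hq, rfl⟩ := hd
  rcases num_den_of_mem_rationals hq with ⟨m, n, -, -, h⟩ | ⟨m, n, -, -, h⟩ <;> omega

theorem mem_denominators_of_eq (a : ℕ → ℕ) (ha : ∀ j, a j ∈ evenAlphabet) (k d : ℕ)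
    (h : (finiteContFrac a (k + 1) : ℚ).den = d) : d ∈ denominators evenAlphabet :=
  ⟨_, by rw [rationals_evenAlphabet_eq]; exact ⟨a, ha, k, rfl⟩, h⟩

theorem image_mod_four_denominators :
    (fun d : ℕ => d % 4) '' denominators evenAlphabet = {0, 1, 2} := by
  ext r
  simp only [Set.mem_image, Set.mem_insert_iff, Set.mem_singleton_iff]
  constructor
  · rintro ⟨d, hd, rfl⟩
    have := mod_four_of_mem_denominators hd
    omega
  · have h2 : 2 ∈ evenAlphabet := by simp [evenAlphabet]
    have h4 : 4 ∈ evenAlphabet := by simp [evenAlphabet]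
    rintro (rfl | rfl | rfl)
    -- Witnesses: `[4] = 1/4`, `[2, 2] = 2/5`, `[2] = 1/2`; the index `k` stands for length `k + 1`.
    · exact ⟨4, mem_denominators_of_eq (fun _ => 4) (fun _ => h4) 0 4
        (by norm_num [finiteContFrac]), rfl⟩
    · exact ⟨5, mem_denominators_of_eq (fun _ => 2) (fun _ => h2) 1 5
        (by norm_num [finiteContFrac]), rfl⟩
    · exact ⟨2, mem_denominators_of_eq (fun _ => 2) (fun _ => h2) 0 2
        (by norm_num [finiteContFrac]), rfl⟩

theorem infinite_compl_denominators : {d : ℕ | d ∉ denominators evenAlphabet}.Infinite := by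
  refine Set.infinite_of_injective_forall_mem (f := fun n : ℕ => 4 * n + 3)
    (fun m n h => by simpa using h) fun n hn => mod_four_of_mem_denominators hn (by omega)

theorem not_eventually_mem_denominators :
    ¬ ∀ᶠ d : ℕ in atTop, d ∈ denominators evenAlphabet := fun h =>
  Nat.frequently_atTop_iff_infinite.2 infinite_compl_denominators (h.mono fun _ hd hn => hn hd)

theorem half_lt_dimH_cantorSet_evenAlphabet :
    ENNReal.ofReal (1 / 2) < dimH (cantorSet evenAlphabet) :=
  ((ENNReal.ofReal_lt_ofReal_iff (by norm_num)).2 (by norm_num)).trans_le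
    le_dimH_cantorSet_evenAlphabet

theorem not_hensleyConjecture : ¬ HensleyConjecture := by
  intro h
  have := h {2, 4, 6, 8, 10} (by decide)
  rw [coe_evenFinset] at this
  exact not_eventually_mem_denominators (this.2 half_lt_dimH_cantorSet_evenAlphabet)

end Zaremba

theorem mainTheorem4 :
    -- the Hausdorff dimension is `0.517…`, which exceeds `1 / 2`
    (ENNReal.ofReal 0.517 ≤ dimH (Zaremba.cantorSet Zaremba.evenAlphabet) ∧
      dimH (Zaremba.cantorSet Zaremba.evenAlphabet) < ENNReal.ofReal 0.518 ∧
      ENNReal.ofReal (1 / 2) < dimH (Zaremba.cantorSet Zaremba.evenAlphabet)) ∧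
    -- every fraction, in lowest terms, is of the form `2m / (4n + 1)` or `(4n + 1) / (2m)`
    (∀ q ∈ Zaremba.rationals Zaremba.evenAlphabet,
      (∃ m n : ℕ, 1 ≤ m ∧ q.num = 2 * (m : ℤ) ∧ q.den = 4 * n + 1) ∨
      (∃ m n : ℕ, 1 ≤ m ∧ q.num = 4 * (n : ℤ) + 1 ∧ q.den = 2 * m)) ∧
    -- the denominators modulo `4` are exactly `0, 1, 2`; in particular never `3`
    (fun d : ℕ => d % 4) '' Zaremba.denominators Zaremba.evenAlphabet = {0, 1, 2} ∧
    -- infinitely many integers are not denominators, so not all large integers are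
    {d : ℕ | d ∉ Zaremba.denominators Zaremba.evenAlphabet}.Infinite ∧
    (¬ ∀ᶠ d : ℕ in atTop, d ∈ Zaremba.denominators Zaremba.evenAlphabet) ∧
    -- Hensley's conjecture is false
    ¬ Zaremba.HensleyConjecture := by
  exact ⟨⟨(ENNReal.ofReal_le_ofReal (by norm_num)).trans Zaremba.le_dimH_cantorSet_evenAlphabet,
      Zaremba.dimH_cantorSet_evenAlphabet_le.trans_lt
        ((ENNReal.ofReal_lt_ofReal_iff (by norm_num)).2 (by norm_num)),
      Zaremba.half_lt_dimH_cantorSet_evenAlphabet⟩,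
    fun _ => Zaremba.num_den_of_mem_rationals, Zaremba.image_mod_four_denominators,
    Zaremba.infinite_compl_denominators, Zaremba.not_eventually_mem_denominators,
    Zaremba.not_hensleyConjecture⟩
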